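/- Let $n\ge 1$, $r\ge 1$ and $s\ge 0$ be integers, and let $\eta=(n_1,\dots,n_r;\,m_1,\dots,m_s)$ be a sequence of positive integers with $(n_1+\dots+n_r)+2(m_1+\dots+m_s)=n$. For $m\ge 1$ let $\mathbb{T}_m(\mathbb{R})$ be the set of lower triangular real $m\times m$ matrices all of whose diagonal entries are equal. Let $\mathbb{S}$ be the set of real matrices of the form $\begin{bmatrix}\alpha&\beta\\-\beta&\alpha\end{bmatrix}$, and let $\mathbb{B}_m(\mathbb{R})$ be the set of real $2m\times 2m$ matrices that, divided into $2\times 2$ blocks, are block lower triangular with all blocks in $\mathbb{S}$ and with all diagonal blocks equal. Let $$\mathcal{K}_{\eta,r,s}(\mathbb{R})=\mathbb{T}_{n_1}(\mathbb{R})\oplus\dots\oplus\mathbb{T}_{n_r}(\mathbb{R})\oplus\mathbb{B}_{m_1}(\mathbb{R})\oplus\dots\oplus\mathbb{B}_{m_s}(\mathbb{R})$$ be the set of block diagonal real $n\times n$ matrices with diagonal blocks, in this order, in the indicated sets, and let $\mathcal{K}^{*}_{\eta,r,s}(\mathbb{R})=\mathcal{K}_{\eta,r,s}(\mathbb{R})\cap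 \mathrm{GL}(n,\mathbb{R})$. **Theorem.** There exist $n-s+1$ (distinct) matrices $A_1,\dots,A_{n-s+1}\in\mathcal{K}^{*}_{\eta,r,s}(\mathbb{R})$ such that the multiplicative semigroup $G$ that they generate is abelian and hypercyclic, that is, there is a vector $v\in\mathbb{R}^n$ whose orbit $G(v)=\{Mv: M\in G\}$ is dense in $\mathbb{R}^n$. -/

import Mathlib

open scoped Matrix

namespace HypercyclicMatrices

/-- The set `𝕋_m(ℝ)`: lower triangular real `m × m` matrices with constant diagonal. -/
def T (m : ℕ) : Set (Matrix (Fin m) (Fin m) ℝ) :=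
  {M | (∃ μ : ℝ, ∀ i, M i i = μ) ∧ ∀ i j, i < j → M i j = 0}

/-- The set `𝕊` of real `2 × 2` matrices of the form `[α, β; -β, α]`. -/
def S : Set (Matrix (Fin 2) (Fin 2) ℝ) :=
  {C | ∃ α β : ℝ, C = !![α, β; -β, α]}

/-- The `2 × 2` block in position `(i, j)` of a `2m × 2m` matrix, whose rows and columns are
indexed by pairs (number of the block, position inside the block). -/
def block {m : ℕ} (M : Matrix (Fin m × Fin 2) (Fin m × Fin 2) ℝ) (i j : Fin m) :
    Matrix (Fin 2) (Fin 2) ℝ :=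
  Matrix.of fun a b => M (i, a) (j, b)

/-- The set `𝔹_m(ℝ)`: real `2m × 2m` matrices which are block lower triangular with `2 × 2` blocks
in `𝕊` and with all the diagonal blocks equal. -/
def B (m : ℕ) : Set (Matrix (Fin m × Fin 2) (Fin m × Fin 2) ℝ) :=
  {M | (∀ i j, block M i j ∈ S) ∧ (∃ C, ∀ i, block M i i = C) ∧ ∀ i j, i < j → block M i j = 0}

/-- The order-preserving numbering by `0, …, n - 1` of the coordinates of
`ℝ^{n_1} ⊕ ⋯ ⊕ ℝ^{n_r} ⊕ ℝ^{2 m_1} ⊕ ⋯ ⊕ ℝ^{2 m_s}`, where `n = ∑ n_k + 2 ∑ m_l`. -/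
def coordEquiv {n r s : ℕ} (ν : Fin r → ℕ) (m : Fin s → ℕ)
    (h : ∑ k, ν k + 2 * ∑ l, m l = n) :
    (Σ k, Fin (ν k)) ⊕ (Σ l, Fin (m l) × Fin 2) ≃ Fin n :=
  (Equiv.sumCongr finSigmaFinEquiv
    ((Equiv.sigmaCongrRight fun _ => finProdFinEquiv).trans finSigmaFinEquiv)).trans
    (finSumFinEquiv.trans (finCongr (by rw [← h, ← Finset.sum_mul, mul_comm])))

/-- The set `𝒦_{η,r,s}(ℝ) = 𝕋_{n_1}(ℝ) ⊕ ⋯ ⊕ 𝕋_{n_r}(ℝ) ⊕ 𝔹_{m_1}(ℝ) ⊕ ⋯ ⊕ 𝔹_{m_s}(ℝ)` of block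
diagonal `n × n` matrices, for `η = (n_1, …, n_r; m_1, …, m_s)`. -/
def K {n r s : ℕ} (ν : Fin r → ℕ) (m : Fin s → ℕ) (h : ∑ k, ν k + 2 * ∑ l, m l = n) :
    Set (Matrix (Fin n) (Fin n) ℝ) :=
  {M | ∃ (P : ∀ k, Matrix (Fin (ν k)) (Fin (ν k)) ℝ)
      (Q : ∀ l, Matrix (Fin (m l) × Fin 2) (Fin (m l) × Fin 2) ℝ),
      (∀ k, P k ∈ T (ν k)) ∧ (∀ l, Q l ∈ B (m l)) ∧
      M = Matrix.reindex (coordEquiv ν m h) (coordEquiv ν m h)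
        (Matrix.fromBlocks (Matrix.blockDiagonal' P) 0 0 (Matrix.blockDiagonal' Q))}

/-- The set `𝒦*_{η,r,s}(ℝ) = 𝒦_{η,r,s}(ℝ) ∩ GL(n, ℝ)`. -/
def KStar {n r s : ℕ} (ν : Fin r → ℕ) (m : Fin s → ℕ) (h : ∑ k, ν k + 2 * ∑ l, m l = n) :
    Set (Matrix (Fin n) (Fin n) ℝ) :=
  {M | M ∈ K ν m h ∧ IsUnit M}

/-- The semigroup `G` of matrices is abelian. -/
def IsAbelian {n : ℕ} (G : Subsemigroup (Matrix (Fin n) (Fin n) ℝ)) : Prop :=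
  ∀ M ∈ G, ∀ N ∈ G, M * N = N * M

/-- The orbit `G(v) = {M v : M ∈ G}`. -/
def orbit {n : ℕ} (G : Subsemigroup (Matrix (Fin n) (Fin n) ℝ)) (v : Fin n → ℝ) :
    Set (Fin n → ℝ) :=
  {w | ∃ M ∈ G, w = M *ᵥ v}

/-- `G` is hypercyclic: some vector of `ℝ^n` has a dense orbit. -/
def IsHypercyclic {n : ℕ} (G : Subsemigroup (Matrix (Fin n) (Fin n) ℝ)) : Prop :=
  ∃ v : Fin n → ℝ, Dense (orbit G v)

end HypercyclicMatrices

open Set Filter Topology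

/-! Inside `K ν m h`, keep only the matrices whose blocks are lower triangular Toeplitz, real or
complex. They form a commutative Banach algebra `ToeplitzProd` of real dimension `n`, and each is
determined by the first columns of its blocks, so applying it to `cyclicVector` identifies the
algebra with `ℝ^n`. Every unit is an exponential up to a sign in each real block
(`exists_exp_ofCoeff`).

Take a real basis `b` of the algebra in which `s` vectors, one per complex block, satisfy `exp (2
b_i) = 1`. The generators are `exp (∑ a_i b_i)` together with `σ_i exp (b_i)` for the `n - s` other
indices, where `σ_i` is 1 or flips one real block. Their products contain the exponentials of all
`(N + 1) a + 2 z` with natural `N` and `z`, since the periodic directions need no generator. A Baire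
argument (`exists_mem_dense_nat_combinations`) gives an `a` for which these vectors are dense, and
the parity of the exponents produces any signs (`exists_semigroup_generators`). -/

/-! ### Dense natural combinations by Baire category. -/

/-- The vector is sought in the negative orthant: there `-(N + 1) a` tends to `+∞`, so natural
multiples of 2 can compensate it. The set `W` leaves room for a further generic condition on `a`,
used to keep the generators distinct. -/
theorem exists_mem_dense_nat_combinations {ι : Type*} [Fintype ι] {W : Set (ι → ℝ)}
    (hWo : IsOpen W) (hWd : Dense W) :
    ∃ a ∈ W, Dense {x : ι → ℝ | ∃ (N : ℕ) (z : ι → ℕ), x = fun i => (N + 1) * a i + 2 * z i} := by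
  classical
  let U : Set (ι → ℝ) → Set (ι → ℝ) := fun V =>
    ⋃ (N : ℕ) (z : ι → ℕ), {a | (fun i => ((N : ℝ) + 1) * a i + 2 * z i) ∈ V}
  have hUo : ∀ V, IsOpen V → IsOpen (U V) := fun V hV =>
    isOpen_iUnion fun N => isOpen_iUnion fun z => hV.preimage (by fun_prop)
  have hUd : ∀ V, V.Nonempty → {a : ι → ℝ | ∀ i, a i < 0} ⊆ closure (U V) := by
    rintro V ⟨q, hq⟩ a ha
    rw [Metric.mem_closure_iff]
    intro η hη
    have h1 : ∀ᶠ N : ℕ in atTop, 2 / ((N : ℝ) + 1) < η := by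
      have : Tendsto (fun N : ℕ => 2 / ((N : ℝ) + 1)) atTop (𝓝 0) :=
        tendsto_const_nhds.div_atTop (tendsto_atTop_add_const_right _ _ tendsto_natCast_atTop_atTop)
      exact this.eventually (gt_mem_nhds hη)
    have h2 : ∀ᶠ N : ℕ in atTop, ∀ i, 0 ≤ q i - ((N : ℝ) + 1) * a i := by
      refine eventually_all.2 fun i => ?_
      have : Tendsto (fun N : ℕ => ((N : ℝ) + 1) * (-a i)) atTop atTop :=
        (tendsto_atTop_add_const_right _ _ tendsto_natCast_atTop_atTop).atTop_mul_const
          (neg_pos.2 (ha i))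
      filter_upwards [this.eventually_ge_atTop (-q i)] with N hN
      linarith
    obtain ⟨N, hN1, hN2⟩ := (h1.and h2).exists
    have hN : (0 : ℝ) < N + 1 := by positivity
    -- Rounding costs at most 2 per coordinate, hence moves `a` by at most `2 / (N + 1)`.
    let z : ι → ℕ := fun i => ⌊(q i - ((N : ℝ) + 1) * a i) / 2⌋₊
    refine ⟨fun i => (q i - 2 * z i) / (N + 1), ?_, ?_⟩
    · simp only [U, mem_iUnion, mem_ofPred_eq]
      refine ⟨N, z, ?_⟩
      convert hq using 2 with i
      field_simp
      ring
    · refine lt_of_le_of_lt ?_ hN1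
      refine (dist_pi_le_iff (by positivity)).2 fun i => ?_
      have l1 : (z i : ℝ) ≤ (q i - ((N : ℝ) + 1) * a i) / 2 :=
        Nat.floor_le (by linarith [hN2 i])
      have l2 : (q i - ((N : ℝ) + 1) * a i) / 2 < z i + 1 := Nat.lt_floor_add_one _
      have : a i - (q i - 2 * z i) / (N + 1) = -((q i - (N + 1) * a i - 2 * z i) / (N + 1)) := by
        field_simp
        ring
      rw [Real.dist_eq, this, abs_neg, abs_div, abs_of_pos hN]
      gcongr
      rw [abs_le]
      constructor <;> linarith
  let 𝓑 := TopologicalSpace.countableBasis (ι → ℝ)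
  have h𝓑 := TopologicalSpace.isBasis_countableBasis (ι → ℝ)
  have : Countable 𝓑 := (TopologicalSpace.countable_countableBasis (ι → ℝ)).to_subtype
  -- `U V` is known to be dense only in the negative orthant. Adding the complement of its closure
  -- makes it dense everywhere and adds no point of that orthant.
  have hd : Dense (⋂ V : Option 𝓑, V.elim W fun V => U V ∪ (closure (U V))ᶜ) := by
    refine dense_iInter_of_isOpen ?_ ?_
    · rintro (_ | V)
      · exact hWo
      · exact (hUo _ (h𝓑.isOpen V.2)).union isClosed_closure.isOpen_compl
    · rintro (_ | V)
      · exact hWd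
      · intro x
        by_cases hx : x ∈ closure (U V)
        · exact closure_mono subset_union_left hx
        · exact subset_closure (Or.inr hx)
  have hneg : IsOpen {a : ι → ℝ | ∀ i, a i < 0} := by
    simp only [ofPred_forall]
    exact isOpen_iInter_of_finite fun i => isOpen_lt (by fun_prop) continuous_const
  obtain ⟨a, ha0, ha⟩ := hd.inter_open_nonempty _ hneg ⟨fun _ => -1, fun _ => by norm_num⟩
  rw [mem_iInter] at ha
  refine ⟨a, ha none, h𝓑.dense_iff.2 fun V hV hne => ?_⟩
  rcases ha (some ⟨V, hV⟩) with h | h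
  · simp only [U, mem_iUnion, mem_ofPred_eq] at h
    obtain ⟨N, z, h⟩ := h
    exact ⟨_, h, N, z, rfl⟩
  · exact absurd (hUd V hne ha0) h

theorem mul_mem_closure_of_mem_submonoid_closure {M : Type*} [Monoid M] {S : Set M} {x m : M}
    (hx : x ∈ Subsemigroup.closure S) (hm : m ∈ Submonoid.closure S) :
    x * m ∈ Subsemigroup.closure S := by
  induction hm using Submonoid.closure_induction generalizing x with
  | mem y hy => exact mul_mem hx (Subsemigroup.subset_closure hy)
  | one => rwa [mul_one]
  | mul y z _ _ ihy ihz => rw [← mul_assoc]; exact ihz (ihy hx)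

/-! ### Generators built from exponentials in a commutative Banach algebra. -/

section Exp

open NormedSpace

theorem exp_eq_exp_iff_exp_sub {C : Type*} [NormedCommRing C] [NormedAlgebra ℚ C]
    [CompleteSpace C] {x y : C} : exp x = exp y ↔ exp (x - y) = 1 := by
  have h : exp x = exp (x - y) * exp y := by rw [← exp_add, sub_add_cancel]
  rw [h]
  exact (isUnit_exp y).mul_eq_right

theorem sum_rescale {E ι : Type*} [AddCommGroup E] [Module ℝ E] [Fintype ι] (p : ι → Prop)
    [DecidablePred p] (b : ι → E) {t : ℝ} (ht : t ≠ 0) (y : ι → ℝ) :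
    ∑ i, (if p i then y i else y i / t) • (if p i then b i else t • b i) = ∑ i, y i • b i := by
  refine Finset.sum_congr rfl fun i _ => ?_
  split_ifs with h
  · rfl
  · rw [smul_smul, div_mul_cancel₀ _ ht]

variable {C : Type*} [NormedCommRing C] [NormedAlgebra ℝ C] [CompleteSpace C]

/-- The curve `t ↦ exp (t • x)` has nonzero derivative `x` at 0. -/
theorem eventually_exp_smul_ne_one {x : C} (hx : x ≠ 0) :
    ∀ᶠ t : ℝ in 𝓝[≠] 0, exp (t • x) ≠ 1 := by
  have h := hasDerivAt_exp_smul_const x (0 : ℝ)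
  refine h.eventually_ne ?_
  simpa using hx

variable [NormedAlgebra ℚ C]

theorem dense_setOf_exp_sum_ne {ι : Type*} [Fintype ι] {b : ι → C} {j : ι} (hj : b j ≠ 0)
    (y : C) : Dense {a : ι → ℝ | exp (∑ i, a i • b i) ≠ exp y} := by
  classical
  intro a
  by_cases ha : exp (∑ i, a i • b i) = exp y
  swap
  · exact subset_closure ha
  let f : ℝ → ι → ℝ := fun u => a + u • Pi.single j (1 : ℝ)
  have hf : Continuous f := by fun_prop
  have hu : Tendsto f (𝓝[≠] 0) (𝓝 a) := by
    refine Tendsto.mono_left ?_ nhdsWithin_le_nhds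
    simpa [f] using hf.tendsto 0
  refine mem_closure_of_tendsto hu ?_
  filter_upwards [eventually_exp_smul_ne_one hj] with u hu h
  refine hu ?_
  have e : ∑ i, f u i • b i = ∑ i, a i • b i + u • b j := by
    simp [f, add_smul, Finset.sum_add_distrib, Pi.single_apply]
  rw [e, exp_add, ha] at h
  exact (isUnit_exp y).mul_eq_left.1 h

theorem isOpen_setOf_exp_sum_ne {ι : Type*} [Fintype ι] (b : ι → C) (y : C) :
    IsOpen {a : ι → ℝ | exp (∑ i, a i • b i) ≠ y} := by
  refine isOpen_ne_fun (exp_continuous.comp ?_) continuous_const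
  fun_prop

theorem exists_injective_exp_rescaling {κ : Type*} [Finite κ] {b : κ → C}
    (hb : Function.Injective b) :
    ∃ t : ℝ, t ≠ 0 ∧ Function.Injective fun i => exp (t • b i) := by
  have h : ∀ᶠ t : ℝ in 𝓝[≠] 0, ∀ i j, i ≠ j → exp (t • (b i - b j)) ≠ 1 := by
    refine eventually_all.2 fun i => eventually_all.2 fun j => ?_
    by_cases hij : i = j
    · simp [hij]
    · filter_upwards [eventually_exp_smul_ne_one (sub_ne_zero.2 (hb.ne hij))] with t ht _
      exact ht
  obtain ⟨t, ht, h0⟩ := (h.and self_mem_nhdsWithin).exists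
  refine ⟨t, h0, fun i j hij => ?_⟩
  by_contra hne
  refine ht i j hne ?_
  rw [smul_sub]
  exact exp_eq_exp_iff_exp_sub.1 hij

/-- Distinctness of the generators is tested on their squares, where the signs `σ i` disappear. -/
theorem exists_semigroup_generators_aux {ι : Type*} [Fintype ι] (p : ι → Prop) [DecidablePred p]
    (b σ : ι → C) (hσ : ∀ i, σ i ^ 2 = 1) (hσp : ∀ i, p i → σ i = 1)
    (hp : ∀ i, p i → exp ((2 : ℝ) • b i) = 1)
    (hinj : Function.Injective fun i : {i // ¬ p i} => exp ((2 : ℝ) • b i)) (h0 : ∃ i, b i ≠ 0) :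
    ∃ g : Option {i // ¬ p i} → C, Function.Injective g ∧ (∀ j, IsUnit (g j)) ∧
      ∀ (ε : ι → ℕ) (y : ι → ℝ), (∏ i, σ i ^ ε i) * exp (∑ i, y i • b i) ∈
        closure (Subsemigroup.closure (range g) : Set C) := by
  obtain ⟨i₀, hi₀⟩ := h0
  have sq : ∀ x : C, exp x ^ 2 = exp ((2 : ℝ) • x) := fun x => by
    rw [pow_two, ← exp_add, two_smul]
  obtain ⟨a, haW, had⟩ := exists_mem_dense_nat_combinations
    (W := ⋂ j : {i // ¬ p i}, {a : ι → ℝ | exp (∑ i, a i • (2 : ℝ) • b i) ≠ exp ((2 : ℝ) • b j)})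
    (isOpen_iInter_of_finite fun j => isOpen_setOf_exp_sum_ne _ _)
    (dense_iInter_of_isOpen (fun j => isOpen_setOf_exp_sum_ne _ _) fun j =>
      dense_setOf_exp_sum_ne (j := i₀) (by simpa using hi₀) _)
  let g : Option {i // ¬ p i} → C := fun j =>
    j.elim (exp (∑ i, a i • b i)) fun i => σ i * exp (b i)
  have hg2 : ∀ i : {i // ¬ p i}, g (some i) ^ 2 = exp ((2 : ℝ) • b i) := fun i => by
    simp only [g, Option.elim_some, mul_pow, hσ, one_mul, sq]
  have hg0 : g none ^ 2 = exp (∑ i, a i • (2 : ℝ) • b i) := by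
    simp only [g, Option.elim_none, sq, Finset.smul_sum]
    simp only [smul_comm (2 : ℝ)]
  have hne : ∀ i : {i // ¬ p i}, g none ≠ g (some i) := fun i h => by
    refine mem_iInter.1 haW i ?_
    rw [← hg0, h, hg2]
  have hmem : ∀ j, g j ∈ (Submonoid.closure (range g)) := fun j =>
    Submonoid.subset_closure (mem_range_self j)
  refine ⟨g, ?_, ?_, fun ε y => ?_⟩
  · rintro (_ | i) (_ | j) h
    · rfl
    · exact absurd h (hne j)
    · exact absurd h.symm (hne i)
    · exact congrArg some (hinj ((hg2 i).symm.trans ((congrArg (· ^ 2) h).trans (hg2 j))))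
  · rintro (_ | i)
    · exact isUnit_exp _
    · exact (IsUnit.of_mul_eq_one (σ i) (by rw [← pow_two, hσ])).mul (isUnit_exp _)
  -- The exponent `ε i + 2 * z i` yields the sign `σ i ^ ε i` but shifts the argument of the
  -- exponential by `ε i`. This shift is fixed, so density survives it.
  · let η : ι → ℝ := fun i => if p i then 0 else ε i
    let F : (ι → ℝ) → C := fun x => (∏ i, σ i ^ ε i) * exp (∑ i, (x i + η i) • b i)
    have hF : Continuous F := by
      refine continuous_const.mul (exp_continuous.comp ?_)
      fun_prop
    have hy : (∏ i, σ i ^ ε i) * exp (∑ i, y i • b i) = F (y - η) := by simp [F]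
    rw [hy]
    refine closure_mono ?_ (hF.range_subset_closure_image_dense had (mem_range_self _))
    rintro _ ⟨_, ⟨N, z, rfl⟩, rfl⟩
    -- With `N + 1` in place of `N`, a factor `g none` is always present, so the product lies in the
    -- semigroup even when all other exponents vanish.
    have key : F (fun i => (N + 1) * a i + 2 * z i) =
        g none * (g none ^ N * ∏ i : {i // ¬ p i}, g (some i) ^ (ε i + 2 * z i)) := by
      have hterm : ∀ i, σ i ^ ε i * exp ((2 * z i + η i) • b i) =
          if ¬ p i then (σ i * exp (b i)) ^ (ε i + 2 * z i) else 1 := fun i => by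
        by_cases hi : p i
        · have : exp ((2 * (z i : ℝ) + η i) • b i) = exp ((2 : ℝ) • b i) ^ z i := by
            rw [← exp_nsmul, ← Nat.cast_smul_eq_nsmul ℝ, smul_smul]
            simp [η, hi, mul_comm]
          rw [this, hp i hi, hσp i hi]
          simp [hi]
        · have : exp ((2 * (z i : ℝ) + η i) • b i) = exp (b i) ^ (ε i + 2 * z i) := by
            rw [← exp_nsmul, ← Nat.cast_smul_eq_nsmul ℝ]
            simp [η, hi, add_comm]
          have hσi : σ i ^ (ε i + 2 * z i) = σ i ^ ε i := by
            rw [pow_add, pow_mul, hσ, one_pow, mul_one]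
          rw [this, mul_pow, hσi, if_pos hi]
      have hprod : ∏ i : {i // ¬ p i}, g (some i) ^ (ε i + 2 * z i) =
          ∏ i, σ i ^ ε i * exp ((2 * z i + η i) • b i) := by
        rw [Finset.prod_congr rfl fun i _ => hterm i, ← Finset.prod_filter,
          Finset.prod_subtype (p := fun i => ¬ p i) (Finset.univ.filter fun i => ¬ p i)
            (fun i => by simp)]
        rfl
      have hsum : ∑ i, ((N + 1) * a i + 2 * z i + η i) • b i =
          (N + 1) • ∑ i, a i • b i + ∑ i, (2 * (z i : ℝ) + η i) • b i := by
        rw [← Nat.cast_smul_eq_nsmul ℝ, Finset.smul_sum, ← Finset.sum_add_distrib]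
        refine Finset.sum_congr rfl fun i _ => ?_
        rw [smul_smul, ← add_smul]
        push_cast
        ring_nf
      rw [hprod, Finset.prod_mul_distrib, ← exp_sum, ← mul_assoc, ← pow_succ']
      simp only [F, g, Option.elim_none]
      rw [hsum, exp_add, exp_nsmul]
      ring
    rw [key]
    exact mul_mem_closure_of_mem_submonoid_closure (Subsemigroup.subset_closure (mem_range_self _))
      (mul_mem (pow_mem (hmem _) _) (prod_mem fun i _ => pow_mem (hmem _) _))

/-- Only the vectors outside `p` are rescaled to make their exponentials distinct; the others must
keep their period. The set of real combinations is unchanged. -/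
theorem exists_semigroup_generators {ι : Type*} [Fintype ι] (p : ι → Prop) [DecidablePred p]
    (b σ : ι → C) (hσ : ∀ i, σ i ^ 2 = 1) (hσp : ∀ i, p i → σ i = 1)
    (hp : ∀ i, p i → exp ((2 : ℝ) • b i) = 1)
    (hinj : Function.Injective fun i : {i // ¬ p i} => b i) (h0 : ∃ i, ¬ p i ∧ b i ≠ 0) :
    ∃ g : Option {i // ¬ p i} → C, Function.Injective g ∧ (∀ j, IsUnit (g j)) ∧
      ∀ (ε : ι → ℕ) (y : ι → ℝ), (∏ i, σ i ^ ε i) * exp (∑ i, y i • b i) ∈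
        closure (Subsemigroup.closure (range g) : Set C) := by
  have hinj' : Function.Injective fun i : {i // ¬ p i} => (2 : ℝ) • b i := fun i j h =>
    hinj (smul_right_injective C (two_ne_zero (α := ℝ)) h)
  obtain ⟨t, ht, hinj⟩ := exists_injective_exp_rescaling hinj'
  obtain ⟨i₀, hpi₀, hi₀⟩ := h0
  obtain ⟨g, hg, hu, hd⟩ := exists_semigroup_generators_aux p
    (fun i => if p i then b i else t • b i) σ hσ hσp (fun i hi => by simpa [hi] using hp i hi)
    (by
      convert hinj using 3 with i
      rw [if_neg i.2, smul_comm])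
    ⟨i₀, by simpa [hpi₀, ht] using hi₀⟩
  refine ⟨g, hg, hu, fun ε y => ?_⟩
  rw [← sum_rescale p b ht]
  exact hd ε _

end Exp

/-! ### Logarithms of unipotent elements. -/

section NilpotentLog

open NormedSpace

variable {C : Type*} [NormedCommRing C] [NormedAlgebra ℚ C]

theorem exists_exp_eq_one_add_add_sq_mul {x : C} (hx : IsNilpotent x) :
    ∃ h : C, exp x = 1 + x + x ^ 2 * h := by
  obtain ⟨k, hk⟩ := hx
  refine ⟨∑ n ∈ Finset.range k, ((n + 2).factorial⁻¹ : ℚ) • x ^ n, ?_⟩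
  have h : exp x = ∑ n ∈ Finset.range (k + 2), (n.factorial⁻¹ : ℚ) • x ^ n := by
    rw [exp_eq_tsum ℚ]
    refine tsum_eq_sum fun n hn => ?_
    rw [Finset.mem_range, not_lt] at hn
    rw [pow_eq_zero_of_le (by omega) hk, smul_zero]
  rw [h, Finset.sum_range_succ', Finset.sum_range_succ', Finset.mul_sum]
  simp only [mul_smul_comm, ← pow_add]
  simp only [pow_one, pow_zero, Nat.factorial_zero, Nat.cast_one, inv_one, one_smul, zero_add,
    Nat.factorial_one, add_assoc, add_comm, add_left_comm]

variable [CompleteSpace C] in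
-- Dividing `1 + x` by `exp x` leaves 1 plus a multiple of `x ^ 2`, whose nilpotency index is
-- smaller; induction avoids the logarithm series.
theorem exists_exp_mul_eq_one_add {x : C} (hx : IsNilpotent x) :
    ∃ y : C, exp (x * y) = 1 + x := by
  obtain ⟨k, hk⟩ := hx
  induction k using Nat.strong_induction_on generalizing x with
  | _ k ih =>
    obtain ⟨h, hh⟩ := exists_exp_eq_one_add_add_sq_mul (x := -x) (IsNilpotent.neg ⟨k, hk⟩)
    rcases Nat.lt_or_ge k 2 with hk2 | hk2
    · have hx0 : x = 0 := by simpa using pow_eq_zero_of_le (by omega : k ≤ 1) hk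
      exact ⟨0, by simp [hx0]⟩
    -- Here `2 * (k - 1) ≥ k` because `k ≥ 2`.
    · have hx' : (x ^ 2 * ((1 + x) * h - 1)) ^ (k - 1) = 0 := by
        rw [mul_pow, ← pow_mul, pow_eq_zero_of_le (by omega) hk, zero_mul]
      obtain ⟨y, hy⟩ := ih (k - 1) (by omega) hx'
      refine ⟨1 + x * ((1 + x) * h - 1) * y, ?_⟩
      have e : x * (1 + x * ((1 + x) * h - 1) * y) = x + x ^ 2 * ((1 + x) * h - 1) * y := by ring
      have hinv : exp x * exp (-x) = 1 := by rw [← exp_add, add_neg_cancel, exp_zero]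
      have : 1 + x ^ 2 * ((1 + x) * h - 1) = exp (-x) * (1 + x) := by rw [hh]; ring
      rw [e, exp_add, hy, this, ← mul_assoc, hinv, one_mul]

end NilpotentLog

/-! ### The algebra of lower triangular Toeplitz matrices. -/

section Toeplitz

open Polynomial

/-- The lower shift matrix. -/
def lowerShift (𝕜 : Type*) [Field 𝕜] (m : ℕ) : Matrix (Fin m) (Fin m) 𝕜 :=
  Matrix.of fun i j => if (i : ℕ) = j + 1 then 1 else 0

theorem lowerShift_pow_apply (𝕜 : Type*) [Field 𝕜] {m : ℕ} (k : ℕ) (i j : Fin m) :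
    (lowerShift 𝕜 m ^ k) i j = if (i : ℕ) = j + k then 1 else 0 := by
  induction k generalizing i j with
  | zero => simp [Matrix.one_apply, Fin.ext_iff]
  | succ k ih =>
    have hs : ∀ i j : Fin m, lowerShift 𝕜 m i j = if (i : ℕ) = j + 1 then 1 else 0 :=
      fun _ _ => rfl
    simp only [pow_succ, Matrix.mul_apply, ih, hs, ← ite_and, mul_ite, mul_one, mul_zero]
    split_ifs with h
    · rw [Finset.sum_eq_single (⟨j + 1, by omega⟩ : Fin m)]
      · rw [if_pos (by simp only [true_and]; omega)]
      · intro l _ hl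
        rw [if_neg]
        rintro ⟨h1, -⟩
        exact hl (Fin.ext h1)
      · simp
    · refine Finset.sum_eq_zero fun l _ => if_neg ?_
      rintro ⟨h1, h2⟩
      omega

theorem lowerShift_pow_eq_zero (𝕜 : Type*) [Field 𝕜] {m k : ℕ} (h : m ≤ k) :
    lowerShift 𝕜 m ^ k = 0 := by
  ext i j
  rw [lowerShift_pow_apply, if_neg (by omega), Matrix.zero_apply]

/-- The subalgebra of lower triangular Toeplitz matrices. -/
noncomputable def toeplitzSubalgebra (𝕜 : Type*) [RCLike 𝕜] (m : ℕ) :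
    Subalgebra 𝕜 (Matrix (Fin m) (Fin m) 𝕜) :=
  (aeval (R := 𝕜) (lowerShift 𝕜 m)).range

/-- The algebra of lower triangular Toeplitz matrices, as a commutative Banach algebra. -/
def Toeplitz (𝕜 : Type*) [RCLike 𝕜] (m : ℕ) : Type _ := toeplitzSubalgebra 𝕜 m

theorem toeplitzSubalgebra_mul_comm {𝕜 : Type*} [RCLike 𝕜] {m : ℕ}
    (x y : toeplitzSubalgebra 𝕜 m) : x * y = y * x := by
  obtain ⟨_, p, rfl⟩ := x
  obtain ⟨_, q, rfl⟩ := y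
  ext1
  change aeval _ p * aeval _ q = aeval _ q * aeval _ p
  rw [← map_mul, mul_comm, map_mul]

variable {𝕜 : Type*} [RCLike 𝕜] {m : ℕ}

noncomputable instance : CommRing (toeplitzSubalgebra 𝕜 m) :=
  { (toeplitzSubalgebra 𝕜 m).toRing with mul_comm := toeplitzSubalgebra_mul_comm }

noncomputable instance : CommRing (Toeplitz 𝕜 m) :=
  inferInstanceAs (CommRing (toeplitzSubalgebra 𝕜 m))

noncomputable instance : Algebra 𝕜 (Toeplitz 𝕜 m) :=
  inferInstanceAs (Algebra 𝕜 (toeplitzSubalgebra 𝕜 m))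

/-- The inclusion of the lower triangular Toeplitz matrices into the algebra of all matrices. -/
noncomputable def Toeplitz.toMatrix : Toeplitz 𝕜 m →ₐ[𝕜] Matrix (Fin m) (Fin m) 𝕜 :=
  (toeplitzSubalgebra 𝕜 m).val

theorem Toeplitz.toMatrix_injective : Function.Injective (toMatrix : Toeplitz 𝕜 m → _) :=
  Subtype.val_injective

section

attribute [local instance] Matrix.linftyOpNormedRing Matrix.linftyOpNormedAlgebra

noncomputable instance : NormedCommRing (Toeplitz 𝕜 m) :=
  NormedCommRing.induced _ _ Toeplitz.toMatrix Toeplitz.toMatrix_injective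

noncomputable instance : NormedAlgebra 𝕜 (Toeplitz 𝕜 m) :=
  NormedAlgebra.induced 𝕜 _ _ Toeplitz.toMatrix

end

noncomputable instance : NormedAlgebra ℚ (Toeplitz 𝕜 m) := NormedAlgebra.restrictScalars ℚ 𝕜 _

namespace Toeplitz

instance : FiniteDimensional 𝕜 (Toeplitz 𝕜 m) :=
  FiniteDimensional.of_injective (toMatrix (𝕜 := 𝕜) (m := m)).toLinearMap toMatrix_injective

instance : CompleteSpace (Toeplitz 𝕜 m) := FiniteDimensional.complete 𝕜 _

/-- The shift, as a Toeplitz matrix. -/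
noncomputable def shift (𝕜 : Type*) [RCLike 𝕜] (m : ℕ) : Toeplitz 𝕜 m :=
  ⟨lowerShift 𝕜 m, X, aeval_X _⟩

theorem toMatrix_shift : toMatrix (shift 𝕜 m) = lowerShift 𝕜 m := rfl

theorem shift_pow_eq_zero {k : ℕ} (h : m ≤ k) : shift 𝕜 m ^ k = 0 :=
  toMatrix_injective <| by
    rw [map_pow, toMatrix_shift, lowerShift_pow_eq_zero 𝕜 h, map_zero]

/-- The Toeplitz matrix with a given first column. -/
noncomputable def ofCoeff (d : Fin m → 𝕜) : Toeplitz 𝕜 m := ∑ j, d j • shift 𝕜 m ^ (j : ℕ)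

theorem toMatrix_ofCoeff_apply (d : Fin m → 𝕜) (i j : Fin m) :
    toMatrix (ofCoeff d) i j =
      if h : j ≤ i then d ⟨i - j, by omega⟩ else 0 := by
  simp only [ofCoeff, map_sum, map_smul, map_pow, toMatrix_shift, Matrix.sum_apply,
    Matrix.smul_apply, lowerShift_pow_apply, smul_eq_mul, mul_ite, mul_one, mul_zero]
  split_ifs with h
  · rw [Fin.le_def] at h
    rw [Finset.sum_eq_single (⟨i - j, by omega⟩ : Fin m)]
    · rw [if_pos]
      simp only
      omega
    · intro l _ hl
      rw [if_neg]
      intro h'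
      exact hl (Fin.ext (by simp only; omega))
    · simp
  · rw [Fin.le_def] at h
    exact Finset.sum_eq_zero fun l _ => if_neg (by omega)

theorem aeval_shift_eq_ofCoeff (p : 𝕜[X]) :
    aeval (shift 𝕜 m) p = ofCoeff fun j : Fin m => p.coeff j := by
  rw [ofCoeff, Fin.sum_univ_eq_sum_range (fun j => p.coeff j • shift 𝕜 m ^ j) m,
    aeval_eq_sum_range' (n := max m (p.natDegree + 1)) (by omega)]
  symm
  refine Finset.sum_subset (by simp) fun j _ hj => ?_
  rw [shift_pow_eq_zero (by simpa using hj), smul_zero]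

theorem exists_aeval_shift_eq (x : Toeplitz 𝕜 m) : ∃ p : 𝕜[X], aeval (shift 𝕜 m) p = x := by
  obtain ⟨_, p, rfl⟩ := x
  refine ⟨p, toMatrix_injective ?_⟩
  rw [← aeval_algHom_apply, toMatrix_shift]
  rfl

theorem ofCoeff_surjective : Function.Surjective (ofCoeff : (Fin m → 𝕜) → Toeplitz 𝕜 m) :=
  fun x => by
    obtain ⟨p, rfl⟩ := exists_aeval_shift_eq x
    exact ⟨_, (aeval_shift_eq_ofCoeff p).symm⟩

theorem exists_ofCoeff_eq_add_shift_mul (hm : 0 < m) (c : Fin m → 𝕜) :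
    ∃ x, ofCoeff c = c ⟨0, hm⟩ • 1 + shift 𝕜 m * x := by
  cases m with
  | zero => omega
  | succ m =>
    refine ⟨∑ j : Fin m, c j.succ • shift 𝕜 (m + 1) ^ (j : ℕ), ?_⟩
    simp only [ofCoeff, Fin.sum_univ_succ, Finset.mul_sum, pow_succ', Fin.val_succ, mul_smul_comm,
      Fin.val_zero, pow_zero]
    rfl

theorem continuous_toMatrix_apply (i j : Fin m) :
    Continuous fun x : Toeplitz 𝕜 m => toMatrix x i j :=
  LinearMap.continuous_of_finiteDimensional
    ((LinearMap.proj j).comp ((LinearMap.proj i).comp (toMatrix (𝕜 := 𝕜) (m := m)).toLinearMap))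

/-- Factoring out the leading coefficient leaves 1 plus a nilpotent. Over `ℝ` the hypothesis on `γ`
forces that coefficient to be positive, which is why signs are needed. -/
theorem exists_exp_ofCoeff (hm : 0 < m) (c : Fin m → 𝕜) (γ : 𝕜)
    (hγ : NormedSpace.exp γ = c ⟨0, hm⟩) :
    ∃ d : Fin m → 𝕜, NormedSpace.exp (ofCoeff d) = ofCoeff c := by
  obtain ⟨x, hx⟩ := exists_ofCoeff_eq_add_shift_mul hm c
  have hc : c ⟨0, hm⟩ ≠ 0 := hγ ▸ (NormedSpace.isUnit_exp γ).ne_zero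
  have hnil : IsNilpotent (shift 𝕜 m * (c ⟨0, hm⟩)⁻¹ • x) :=
    ⟨m, by rw [mul_pow, shift_pow_eq_zero le_rfl, zero_mul]⟩
  obtain ⟨y, hy⟩ := exists_exp_mul_eq_one_add hnil
  obtain ⟨d, hd⟩ := ofCoeff_surjective
    (algebraMap 𝕜 (Toeplitz 𝕜 m) γ + (shift 𝕜 m * (c ⟨0, hm⟩)⁻¹ • x) * y)
  refine ⟨d, ?_⟩
  rw [hd, NormedSpace.exp_add, hy, ← NormedSpace.algebraMap_exp_comm, hγ, hx,
    Algebra.algebraMap_eq_smul_one, smul_mul_assoc, one_mul, smul_add, mul_smul_comm,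
    smul_inv_smul₀ hc]

end Toeplitz

end Toeplitz

/-! ### Complex matrices as real block matrices. -/

section Realify

/-- The real `2 × 2` matrix `[re z, im z; -im z, re z]` representing a complex number. -/
def complexBlock (z : ℂ) : Matrix (Fin 2) (Fin 2) ℝ := !![z.re, z.im; -z.im, z.re]

/-- Replace every entry of a complex matrix by the real `2 × 2` matrix representing it. -/
def realify {m : ℕ} (Q : Matrix (Fin m) (Fin m) ℂ) : Matrix (Fin m × Fin 2) (Fin m × Fin 2) ℝ :=
  Matrix.of fun x y => complexBlock (Q x.1 y.1) x.2 y.2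

theorem realify_apply {m : ℕ} (Q : Matrix (Fin m) (Fin m) ℂ) (i j : Fin m) (a b : Fin 2) :
    realify Q (i, a) (j, b) = complexBlock (Q i j) a b := rfl

theorem complexBlock_mul (z w : ℂ) :
    complexBlock (z * w) = complexBlock z * complexBlock w := by
  ext a b
  fin_cases a <;> fin_cases b <;> simp [complexBlock, Matrix.mul_apply, Fin.sum_univ_two] <;> ring

theorem complexBlock_sum_apply {ι : Type*} (s : Finset ι) (f : ι → ℂ) (a b : Fin 2) :
    complexBlock (∑ i ∈ s, f i) a b = ∑ i ∈ s, complexBlock (f i) a b := by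
  fin_cases a <;> fin_cases b <;> simp [complexBlock]

theorem complexBlock_injective : Function.Injective complexBlock := fun z w h => by
  have h0 := congrFun (congrFun h 0) 0
  have h1 := congrFun (congrFun h 0) 1
  exact Complex.ext h0 h1

theorem realify_injective {m : ℕ} :
    Function.Injective (realify : Matrix (Fin m) (Fin m) ℂ → _) := fun P Q h => by
  ext1 i j
  refine complexBlock_injective ?_
  ext a b
  exact congrFun (congrFun h (i, a)) (j, b)

theorem realify_one {m : ℕ} : realify (1 : Matrix (Fin m) (Fin m) ℂ) = 1 := by
  ext ⟨i, a⟩ ⟨j, b⟩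
  rw [realify_apply, Matrix.one_apply, Matrix.one_apply]
  by_cases h : i = j
  · subst h
    fin_cases a <;> fin_cases b <;> simp [complexBlock]
  · rw [if_neg h, if_neg (fun h' => h (Prod.ext_iff.1 h').1)]
    fin_cases a <;> fin_cases b <;> simp [complexBlock]

theorem realify_mul {m : ℕ} (P Q : Matrix (Fin m) (Fin m) ℂ) :
    realify (P * Q) = realify P * realify Q := by
  ext ⟨i, a⟩ ⟨j, b⟩
  rw [realify_apply, Matrix.mul_apply, complexBlock_sum_apply, Matrix.mul_apply,
    Fintype.sum_prod_type]
  refine Finset.sum_congr rfl fun l _ => ?_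
  rw [complexBlock_mul, Matrix.mul_apply]
  rfl

end Realify

namespace Toeplitz

theorem toMatrix_mem_T {m : ℕ} (hm : 0 < m) (x : Toeplitz ℝ m) :
    toMatrix x ∈ HypercyclicMatrices.T m := by
  obtain ⟨d, rfl⟩ := ofCoeff_surjective x
  refine ⟨⟨d ⟨0, hm⟩, fun i => ?_⟩, fun i j hij => ?_⟩
  · simp [toMatrix_ofCoeff_apply]
  · rw [toMatrix_ofCoeff_apply, dif_neg (not_le.2 hij)]

theorem realify_toMatrix_mem_B {m : ℕ} (hm : 0 < m) (x : Toeplitz ℂ m) :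
    realify (toMatrix x) ∈ HypercyclicMatrices.B m := by
  have hb : ∀ i j, HypercyclicMatrices.block (realify (toMatrix x)) i j =
    complexBlock (toMatrix x i j) := fun i j => rfl
  obtain ⟨d, rfl⟩ := ofCoeff_surjective x
  refine ⟨fun i j => ⟨_, _, hb i j⟩, ⟨complexBlock (d ⟨0, hm⟩), fun i => ?_⟩, fun i j hij => ?_⟩
  · rw [hb]
    simp [toMatrix_ofCoeff_apply]
  · rw [hb, toMatrix_ofCoeff_apply, dif_neg (not_le.2 hij)]
    ext a b
    fin_cases a <;> fin_cases b <;> simp [complexBlock]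

theorem toMatrix_ofCoeff_apply_zero {𝕜 : Type*} [RCLike 𝕜] {m : ℕ} (hm : 0 < m) (d : Fin m → 𝕜)
    (i : Fin m) : toMatrix (ofCoeff d) i ⟨0, hm⟩ = d i := by
  rw [toMatrix_ofCoeff_apply, dif_pos (Fin.le_def.2 (Nat.zero_le _))]
  rfl

theorem ofCoeff_injective {𝕜 : Type*} [RCLike 𝕜] {m : ℕ} :
    Function.Injective (ofCoeff : (Fin m → 𝕜) → Toeplitz 𝕜 m) := fun c d h => by
  ext i
  have hm : 0 < m := i.pos
  rw [← toMatrix_ofCoeff_apply_zero hm c, h, toMatrix_ofCoeff_apply_zero]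

end Toeplitz

/-! ### The block diagonal embedding and its cyclic vector. -/

namespace HypercyclicMatrices

open Toeplitz

variable {n r s : ℕ} (ν : Fin r → ℕ) (m : Fin s → ℕ)

/-- The commutative Banach algebra of tuples of Toeplitz matrices, real of sizes `ν`, complex of
sizes `m`. -/
abbrev ToeplitzProd : Type := (∀ k, Toeplitz ℝ (ν k)) × (∀ l, Toeplitz ℂ (m l))

/-- The index set of the coordinates. -/
abbrev Coord : Type := (Σ k, Fin (ν k)) ⊕ (Σ l, Fin (m l) × Fin 2)

variable (h : ∑ k, ν k + 2 * ∑ l, m l = n)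

/-- Tuples of Toeplitz matrices as block diagonal real matrices. -/
noncomputable def toKMatrix : ToeplitzProd ν m →* Matrix (Fin n) (Fin n) ℝ where
  toFun c := Matrix.reindex (coordEquiv ν m h) (coordEquiv ν m h)
    (Matrix.fromBlocks (Matrix.blockDiagonal' fun k => toMatrix (c.1 k)) 0 0
      (Matrix.blockDiagonal' fun l => realify (toMatrix (c.2 l))))
  map_one' := by
    have h1 : (fun k => toMatrix ((1 : ToeplitzProd ν m).1 k)) = 1 := by
      funext k
      exact map_one (toMatrix (𝕜 := ℝ))
    have h2 : (fun l => realify (toMatrix ((1 : ToeplitzProd ν m).2 l))) = 1 := by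
      funext l
      exact (congrArg realify (map_one (toMatrix (𝕜 := ℂ)))).trans realify_one
    rw [h1, h2, Matrix.blockDiagonal'_one, Matrix.blockDiagonal'_one, Matrix.fromBlocks_one]
    simp
  map_mul' c d := by
    have h1 : (fun k => toMatrix ((c * d).1 k)) =
        fun k => toMatrix (c.1 k) * toMatrix (d.1 k) := by
      funext k
      exact map_mul (toMatrix (𝕜 := ℝ)) _ _
    have h2 : (fun l => realify (toMatrix ((c * d).2 l))) =
        fun l => realify (toMatrix (c.2 l)) * realify (toMatrix (d.2 l)) := by
      funext l
      exact (congrArg realify (map_mul (toMatrix (𝕜 := ℂ)) _ _)).trans (realify_mul _ _)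
    rw [h1, h2, Matrix.blockDiagonal'_mul, Matrix.blockDiagonal'_mul]
    simp [Matrix.submatrix_mul_equiv, Matrix.fromBlocks_multiply]

theorem toKMatrix_injective : Function.Injective (toKMatrix ν m h) := fun c d hcd => by
  have h1 := (Matrix.reindex _ _).injective hcd
  obtain ⟨h1, -, -, h2⟩ := Matrix.fromBlocks_inj.1 h1
  refine Prod.ext (funext fun k => toMatrix_injective ?_)
    (funext fun l => toMatrix_injective (realify_injective ?_))
  · exact congrFun (Matrix.blockDiagonal'_injective h1) k
  · exact congrFun (Matrix.blockDiagonal'_injective h2) l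

theorem toKMatrix_mem_K (hν : ∀ k, 0 < ν k) (hm : ∀ l, 0 < m l) (c : ToeplitzProd ν m) :
    toKMatrix ν m h c ∈ K ν m h :=
  ⟨_, _, fun k => toMatrix_mem_T (hν k) (c.1 k), fun l => realify_toMatrix_mem_B (hm l) (c.2 l),
    rfl⟩

/-- The indicator of the coordinates which are first in their block. -/
noncomputable def cyclicVector : Fin n → ℝ := fun x =>
  Sum.elim (fun i => if (i.2 : ℕ) = 0 then 1 else 0)
    (fun i => if (i.2.1 : ℕ) = 0 ∧ i.2.2 = 0 then 1 else 0) ((coordEquiv ν m h).symm x)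

theorem toKMatrix_mulVec_inl (hν : ∀ k, 0 < ν k) (c : ToeplitzProd ν m) (k : Fin r)
    (j : Fin (ν k)) :
    (toKMatrix ν m h c *ᵥ cyclicVector ν m h) (coordEquiv ν m h (Sum.inl ⟨k, j⟩)) =
      toMatrix (c.1 k) j ⟨0, hν k⟩ := by
  rw [Matrix.mulVec, dotProduct, ← (coordEquiv ν m h).sum_comp,
    Finset.sum_eq_single (Sum.inl ⟨k, ⟨0, hν k⟩⟩)]
  · simp [toKMatrix, cyclicVector, Matrix.blockDiagonal'_apply_eq]
  · rintro (⟨k', j'⟩ | ⟨l, j', b⟩) _ hne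
    · by_cases hk : k = k'
      · subst hk
        have : (j' : ℕ) ≠ 0 := fun h0 => hne (by
          congr 2
          exact Fin.ext h0)
        simp [cyclicVector, this]
      · simp [toKMatrix, Matrix.blockDiagonal'_apply_ne _ _ _ hk]
    · simp [toKMatrix]
  · simp

theorem toKMatrix_mulVec_inr (hm : ∀ l, 0 < m l) (c : ToeplitzProd ν m) (l : Fin s)
    (j : Fin (m l)) (a : Fin 2) :
    (toKMatrix ν m h c *ᵥ cyclicVector ν m h) (coordEquiv ν m h (Sum.inr ⟨l, j, a⟩)) =
      complexBlock (toMatrix (c.2 l) j ⟨0, hm l⟩) a 0 := by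
  rw [Matrix.mulVec, dotProduct, ← (coordEquiv ν m h).sum_comp,
    Finset.sum_eq_single (Sum.inr ⟨l, ⟨0, hm l⟩, 0⟩)]
  · simp [toKMatrix, cyclicVector, Matrix.blockDiagonal'_apply_eq, realify_apply]
  · rintro (⟨k', j'⟩ | ⟨l', j', b⟩) _ hne
    · simp [toKMatrix]
    · by_cases hl : l = l'
      · subst hl
        have : ¬ ((j' : ℕ) = 0 ∧ b = 0) := fun h0 => hne (by
          obtain ⟨h0, rfl⟩ := h0
          congr 3
          exact Fin.ext h0)
        simp [cyclicVector, this]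
      · simp [toKMatrix, Matrix.blockDiagonal'_apply_ne _ _ _ hl]
  · simp

theorem continuous_toKMatrix_mulVec (hν : ∀ k, 0 < ν k) (hm : ∀ l, 0 < m l) :
    Continuous fun c => toKMatrix ν m h c *ᵥ cyclicVector ν m h := by
  refine continuous_pi fun x => ?_
  obtain ⟨i, rfl⟩ := (coordEquiv ν m h).surjective x
  rcases i with ⟨k, j⟩ | ⟨l, j, a⟩
  · simp only [toKMatrix_mulVec_inl ν m h hν]
    exact (continuous_toMatrix_apply _ _).comp ((continuous_apply k).comp continuous_fst)
  · simp only [toKMatrix_mulVec_inr ν m h hm]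
    have : Continuous fun c : ToeplitzProd ν m => toMatrix (c.2 l) j ⟨0, hm l⟩ :=
      (continuous_toMatrix_apply _ _).comp ((continuous_apply l).comp continuous_snd)
    fin_cases a
    · exact Complex.continuous_re.comp this
    · exact (Complex.continuous_im.comp this).neg

end HypercyclicMatrices

/-! ### The basis, the signs and the coordinates of the orbit. -/

namespace HypercyclicMatrices

open Toeplitz

variable {n r s : ℕ} (ν : Fin r → ℕ) (m : Fin s → ℕ)

/-- The real basis `1, I` of `ℂ`, or `1, π * I` in the leading position. -/
noncomputable def complexUnit (j : ℕ) (a : Fin 2) : ℂ :=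
  if a = 0 then 1 else if j = 0 then Real.pi * Complex.I else Complex.I

/-- A real basis of the algebra of tuples of Toeplitz matrices. -/
noncomputable def toeplitzBasis : Coord ν m → ToeplitzProd ν m :=
  Sum.elim (fun i => (Pi.single i.1 (shift ℝ _ ^ (i.2 : ℕ)), 0))
    (fun i => (0, Pi.single i.1 (complexUnit i.2.1 i.2.2 • shift ℂ _ ^ (i.2.1 : ℕ))))

/-- The involutions changing the sign of one real block. -/
noncomputable def blockSign : Coord ν m → ToeplitzProd ν m :=
  Sum.elim (fun i => if (i.2 : ℕ) = 0 then (Function.update 1 i.1 (-1), 1) else 1) 1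

/-- The coordinates along which the exponential is periodic. -/
def IsAngular : Coord ν m → Prop :=
  Sum.elim (fun _ => False) fun i => (i.2.1 : ℕ) = 0 ∧ i.2.2 = 1

theorem blockSign_sq (i : Coord ν m) : blockSign ν m i ^ 2 = 1 := by
  rcases i with ⟨k, j⟩ | i
  · simp only [blockSign, Sum.elim_inl]
    split_ifs
    · refine Prod.ext ?_ (one_pow _)
      funext k'
      by_cases hk : k' = k
      · subst hk
        simp
      · simp [hk]
    · exact one_pow _
  · exact one_pow _

theorem blockSign_of_isAngular {i : Coord ν m} (hi : IsAngular ν m i) : blockSign ν m i = 1 := by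
  rcases i with i | i
  · exact hi.elim
  · rfl

theorem exp_fst_apply (c : ToeplitzProd ν m) (k : Fin r) :
    (NormedSpace.exp c).1 k = NormedSpace.exp (c.1 k) := by
  rw [Prod.fst_exp, Pi.coe_exp]

theorem exp_snd_apply (c : ToeplitzProd ν m) (l : Fin s) :
    (NormedSpace.exp c).2 l = NormedSpace.exp (c.2 l) := by
  rw [Prod.snd_exp, Pi.coe_exp]

theorem exp_two_smul_of_isAngular {i : Coord ν m} (hi : IsAngular ν m i) :
    NormedSpace.exp ((2 : ℝ) • toeplitzBasis ν m i) = 1 := by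
  rcases i with i | ⟨l, j, a⟩
  · exact hi.elim
  obtain ⟨hj, ha⟩ : (j : ℕ) = 0 ∧ a = 1 := hi
  refine Prod.ext (funext fun k => ?_) (funext fun l' => ?_)
  · rw [exp_fst_apply]
    simp [toeplitzBasis]
  · rw [exp_snd_apply]
    by_cases hl : l' = l
    · subst hl
      have : ((2 : ℝ) • toeplitzBasis ν m (Sum.inr ⟨l', j, a⟩)).2 l' =
          algebraMap ℂ (Toeplitz ℂ (m l')) (2 * Real.pi * Complex.I) := by
        simp [toeplitzBasis, hj, ha, complexUnit, Algebra.algebraMap_eq_smul_one, mul_assoc,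
          mul_smul, ofNat_smul_eq_nsmul]
      rw [this, ← NormedSpace.algebraMap_exp_comm, ← Complex.exp_eq_exp_ℂ, Complex.exp_two_pi_mul_I,
        map_one]
      rfl
    · simp [toeplitzBasis, hl]

theorem sum_smul_toeplitzBasis_fst (y : Coord ν m → ℝ) (k : Fin r) :
    (∑ i, y i • toeplitzBasis ν m i).1 k = ofCoeff fun j => y (Sum.inl ⟨k, j⟩) := by
  rw [Prod.fst_sum, Finset.sum_apply, Fintype.sum_sum_type, Fintype.sum_sigma,
    Finset.sum_eq_single k]
  · simp [toeplitzBasis, ofCoeff]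
  · intro k' _ hk
    simp [toeplitzBasis, hk.symm]
  · simp

theorem sum_smul_toeplitzBasis_snd (y : Coord ν m → ℝ) (l : Fin s) :
    (∑ i, y i • toeplitzBasis ν m i).2 l =
      ofCoeff fun j => ∑ a, (y (Sum.inr ⟨l, j, a⟩) : ℂ) * complexUnit j a := by
  rw [Prod.snd_sum, Finset.sum_apply, Fintype.sum_sum_type,
    Finset.sum_eq_zero (fun i _ => by simp [toeplitzBasis]), zero_add, Fintype.sum_sigma,
    Finset.sum_eq_single l]
  · simp [toeplitzBasis, ofCoeff, Fintype.sum_prod_type, add_smul, mul_smul]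
  · intro l' _ hl
    simp [toeplitzBasis, hl.symm]
  · simp

theorem exists_complexUnit_combination (j : ℕ) (z : ℂ) :
    ∃ y : Fin 2 → ℝ, ∑ a, (y a : ℂ) * complexUnit j a = z := by
  by_cases hj : j = 0
  · refine ⟨![z.re, z.im / Real.pi], ?_⟩
    have : (Real.pi : ℂ) ≠ 0 := by exact_mod_cast Real.pi_ne_zero
    simp only [Fin.sum_univ_two, complexUnit, hj]
    simp [← mul_assoc, this]
  · refine ⟨![z.re, z.im], ?_⟩
    simp [complexUnit, hj, Fin.sum_univ_two]

theorem eq_zero_of_complexUnit_combination {j : ℕ} {y : Fin 2 → ℝ}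
    (hy : ∑ a, (y a : ℂ) * complexUnit j a = 0) (a : Fin 2) : y a = 0 := by
  have h0 := congrArg Complex.re hy
  have h1 := congrArg Complex.im hy
  by_cases hj : j = 0
  · simp [Fin.sum_univ_two, complexUnit, hj, Real.pi_ne_zero] at h0 h1
    fin_cases a <;> assumption
  · simp [Fin.sum_univ_two, complexUnit, hj] at h0 h1
    fin_cases a <;> assumption

theorem linearIndependent_toeplitzBasis : LinearIndependent ℝ (toeplitzBasis ν m) := by
  rw [Fintype.linearIndependent_iff]
  intro y hy i
  have hz : ∀ {𝕜 : Type} [RCLike 𝕜] {m : ℕ}, ofCoeff (0 : Fin m → 𝕜) = 0 := by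
    intros
    simp [ofCoeff]
  rcases i with ⟨k, j⟩ | ⟨l, j, a⟩
  · have := sum_smul_toeplitzBasis_fst ν m y k
    rw [hy] at this
    exact congrFun (ofCoeff_injective (this.symm.trans hz.symm)) j
  · have := sum_smul_toeplitzBasis_snd ν m y l
    rw [hy] at this
    exact eq_zero_of_complexUnit_combination (y := fun a => y (Sum.inr ⟨l, j, a⟩))
      (congrFun (ofCoeff_injective (this.symm.trans hz.symm)) j) a

theorem prod_blockSign_pow_snd (ε : Coord ν m → ℕ) (l : Fin s) :
    (∏ i, blockSign ν m i ^ ε i).2 l = 1 := by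
  rw [Prod.snd_prod, Finset.prod_apply]
  refine Finset.prod_eq_one fun i _ => ?_
  rcases i with ⟨k, j⟩ | i
  · simp only [blockSign, Sum.elim_inl]
    split_ifs <;> simp
  · simp [blockSign]

theorem prod_blockSign_pow_fst (hν : ∀ k, 0 < ν k) (ε : Coord ν m → ℕ) (k : Fin r) :
    (∏ i, blockSign ν m i ^ ε i).1 k = (-1) ^ ε (Sum.inl ⟨k, ⟨0, hν k⟩⟩) := by
  rw [Prod.fst_prod, Finset.prod_apply, Finset.prod_eq_single (Sum.inl ⟨k, ⟨0, hν k⟩⟩)]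
  · simp [blockSign]
  · rintro (⟨k', j⟩ | i) _ hne
    · simp only [blockSign, Sum.elim_inl]
      split_ifs with hj
      · have hk : k ≠ k' := by
          rintro rfl
          refine hne ?_
          congr 2
          exact Fin.ext hj
        simp [hk]
      · simp
    · simp [blockSign]
  · simp

theorem card_not_isAngular [DecidablePred (IsAngular ν m)] (hm : ∀ l, 0 < m l)
    (h : ∑ k, ν k + 2 * ∑ l, m l = n) :
    Fintype.card {i // ¬ IsAngular ν m i} = n - s := by
  have e : {i // IsAngular ν m i} ≃ Fin s :=
    { toFun := fun i => match i with
        | ⟨Sum.inl _, hi⟩ => hi.elim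
        | ⟨Sum.inr x, _⟩ => x.1
      invFun := fun l => ⟨Sum.inr ⟨l, ⟨0, hm l⟩, 1⟩, rfl, rfl⟩
      left_inv := by
        rintro ⟨i | ⟨l, ⟨j, hj'⟩, a⟩, hi⟩
        · exact hi.elim
        · obtain ⟨hj, ha⟩ : j = 0 ∧ a = 1 := hi
          subst hj ha
          rfl
      right_inv := fun l => rfl }
  rw [Fintype.card_subtype_compl, Fintype.card_congr e, Fintype.card_congr (coordEquiv ν m h),
    Fintype.card_fin, Fintype.card_fin]

variable (h : ∑ k, ν k + 2 * ∑ l, m l = n)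

/-- The coordinates of `w` are read as first columns of Toeplitz blocks. Nonzero coordinates make
the leading coefficients invertible; `ε` records the negative ones. -/
theorem exists_toKMatrix_mulVec_eq (hν : ∀ k, 0 < ν k) (hm : ∀ l, 0 < m l) {w : Fin n → ℝ}
    (hw : ∀ x, w x ≠ 0) :
    ∃ (ε : Coord ν m → ℕ) (y : Coord ν m → ℝ),
      toKMatrix ν m h ((∏ i, blockSign ν m i ^ ε i) *
        NormedSpace.exp (∑ i, y i • toeplitzBasis ν m i)) *ᵥ cyclicVector ν m h = w := by
  let u : Coord ν m → ℝ := fun i => w (coordEquiv ν m h i)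
  let ε : Coord ν m → ℕ := fun i => if u i < 0 then 1 else 0
  have hR : ∀ k, ∃ d : Fin (ν k) → ℝ, NormedSpace.exp (ofCoeff d) =
      ofCoeff fun j => (-1) ^ ε (Sum.inl ⟨k, ⟨0, hν k⟩⟩) * u (Sum.inl ⟨k, j⟩) := fun k => by
    refine exists_exp_ofCoeff (hν k) _ (Real.log |u (Sum.inl ⟨k, ⟨0, hν k⟩⟩)|) ?_
    rw [← Real.exp_eq_exp_ℝ, Real.exp_log (abs_pos.2 (hw _))]
    simp only [ε]
    split_ifs with hneg
    · rw [abs_of_neg hneg]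
      ring
    · rw [abs_of_nonneg (not_lt.1 hneg)]
      ring
  -- The first column of `complexBlock z` is `(re z, -im z)`, hence the minus sign.
  have hC : ∀ l, ∃ d : Fin (m l) → ℂ, NormedSpace.exp (ofCoeff d) =
      ofCoeff fun j => (⟨u (Sum.inr ⟨l, j, 0⟩), -u (Sum.inr ⟨l, j, 1⟩)⟩ : ℂ) := fun l => by
    refine exists_exp_ofCoeff (hm l) _
      (Complex.log ⟨u (Sum.inr ⟨l, ⟨0, hm l⟩, 0⟩), -u (Sum.inr ⟨l, ⟨0, hm l⟩, 1⟩)⟩) ?_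
    rw [← Complex.exp_eq_exp_ℂ, Complex.exp_log]
    exact fun h0 => hw _ (congrArg Complex.re h0)
  choose dR hdR using hR
  choose dC hdC using hC
  choose yC hyC using fun l j => exists_complexUnit_combination (j : Fin (m l)) (dC l j)
  refine ⟨ε, Sum.elim (fun i => dR i.1 i.2) (fun i => yC i.1 i.2.1 i.2.2), ?_⟩
  funext x
  obtain ⟨i, rfl⟩ := (coordEquiv ν m h).surjective x
  rcases i with ⟨k, j⟩ | ⟨l, j, a⟩
  · rw [toKMatrix_mulVec_inl ν m h hν, Prod.fst_mul, Pi.mul_apply, prod_blockSign_pow_fst ν m hν,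
      exp_fst_apply, sum_smul_toeplitzBasis_fst]
    simp only [Sum.elim_inl]
    rw [hdR]
    rcases Nat.even_or_odd (ε (Sum.inl ⟨k, ⟨0, hν k⟩⟩)) with he | he
    · have h1 (x : Toeplitz ℝ (ν k)) : (-1) ^ ε (Sum.inl ⟨k, ⟨0, hν k⟩⟩) * x = x := by
        rw [he.neg_one_pow, one_mul]
      refine (congrArg (fun x => toMatrix x j ⟨0, hν k⟩) (h1 _)).trans ?_
      rw [toMatrix_ofCoeff_apply_zero, he.neg_one_pow, one_mul]
    · have h1 (x : Toeplitz ℝ (ν k)) : (-1) ^ ε (Sum.inl ⟨k, ⟨0, hν k⟩⟩) * x = -x := by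
        rw [he.neg_one_pow, neg_mul, one_mul]
      refine (congrArg (fun x => toMatrix x j ⟨0, hν k⟩) (h1 _)).trans ?_
      rw [map_neg, Matrix.neg_apply, toMatrix_ofCoeff_apply_zero, he.neg_one_pow, neg_mul, one_mul,
        neg_neg]
  · rw [toKMatrix_mulVec_inr ν m h hm, Prod.snd_mul, Pi.mul_apply, prod_blockSign_pow_snd,
      exp_snd_apply, sum_smul_toeplitzBasis_snd, one_mul]
    simp only [Sum.elim_inr, hyC]
    rw [hdC, toMatrix_ofCoeff_apply_zero]
    fin_cases a <;> simp [complexBlock, u]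

theorem dense_setOf_forall_ne_zero (ι : Type*) : Dense {w : ι → ℝ | ∀ x, w x ≠ 0} := by
  have := dense_pi (univ : Set ι) fun (_ : ι) _ => dense_compl_singleton (0 : ℝ)
  simpa [Set.pi] using this

theorem coe_closure_range_comp {M N ι κ : Type*} [Monoid M] [Monoid N] (f : M →* N) (g : ι → M)
    (e : κ ≃ ι) : (Subsemigroup.closure (range (f ∘ g ∘ e)) : Set N) =
      f '' (Subsemigroup.closure (range g)) := by
  rw [range_comp, e.surjective.range_comp]
  exact congrArg SetLike.coe (MulHom.map_mclosure (f : M →ₙ* N) (range g)).symm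

end HypercyclicMatrices

/-! ### Conclusion. -/

open HypercyclicMatrices in
theorem theorem1p7 (n r s : ℕ) (hr : 1 ≤ r) (ν : Fin r → ℕ) (m : Fin s → ℕ)
    (hν : ∀ k, 0 < ν k) (hm : ∀ l, 0 < m l) (h : ∑ k, ν k + 2 * ∑ l, m l = n) :
    ∃ A : Fin (n - s + 1) → Matrix (Fin n) (Fin n) ℝ,
      Function.Injective A ∧
      (∀ j, A j ∈ HypercyclicMatrices.KStar ν m h) ∧
      HypercyclicMatrices.IsAbelian (Subsemigroup.closure (Set.range A)) ∧
      HypercyclicMatrices.IsHypercyclic (Subsemigroup.closure (Set.range A)) := by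
  classical
  have hb := linearIndependent_toeplitzBasis ν m
  obtain ⟨g, hg, hu, hd⟩ := exists_semigroup_generators (IsAngular ν m) (toeplitzBasis ν m)
    (blockSign ν m) (blockSign_sq ν m) (fun i => blockSign_of_isAngular ν m)
    (fun i => exp_two_smul_of_isAngular ν m) (hb.injective.comp Subtype.val_injective)
    -- The first real block supplies a nonzero basis vector that is not angular.
    ⟨Sum.inl ⟨⟨0, hr⟩, ⟨0, hν _⟩⟩, fun h => h, hb.ne_zero _⟩
  let e : Fin (n - s + 1) ≃ Option {i // ¬ IsAngular ν m i} :=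
    (Fintype.equivFinOfCardEq (by rw [Fintype.card_option, card_not_isAngular ν m hm h])).symm
  have hcl := coe_closure_range_comp (toKMatrix ν m h) g e
  refine ⟨toKMatrix ν m h ∘ g ∘ e, ?_, fun j => ⟨toKMatrix_mem_K ν m h hν hm _, ?_⟩, ?_,
    cyclicVector ν m h, ?_⟩
  · exact (toKMatrix_injective ν m h).comp (hg.comp e.injective)
  · exact (hu _).map _
  · intro M hM N hN
    rw [← SetLike.mem_coe, hcl] at hM hN
    obtain ⟨x, -, rfl⟩ := hM
    obtain ⟨y, -, rfl⟩ := hN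
    rw [← map_mul, mul_comm, map_mul]
  · let E : ToeplitzProd ν m → Fin n → ℝ := fun c => toKMatrix ν m h c *ᵥ cyclicVector ν m h
    have horb : E '' (Subsemigroup.closure (range g)) ⊆
        orbit (Subsemigroup.closure (range (toKMatrix ν m h ∘ g ∘ e))) (cyclicVector ν m h) := by
      rintro _ ⟨x, hx, rfl⟩
      refine ⟨toKMatrix ν m h x, ?_, rfl⟩
      rw [← SetLike.mem_coe, hcl]
      exact mem_image_of_mem _ hx
    refine Dense.mono horb (dense_closure.1 ((dense_setOf_forall_ne_zero (Fin n)).mono ?_))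
    intro w hw
    obtain ⟨ε, y, rfl⟩ := exists_toKMatrix_mulVec_eq ν m h hν hm hw
    exact image_closure_subset_closure_image (continuous_toKMatrix_mulVec ν m h hν hm)
      (mem_image_of_mem _ (hd ε y))
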